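/- Let $m\ge 1$ be an integer. Let $e_1=x_1+x_2$, $e_2=x_1x_2$, $e_1(m)=x_1^m+x_2^m$, $e_2(m)=x_1^mx_2^m$ in $\mathbb{Q}[x_1,x_2]$, and let $$A=A(m,2)=\mathbb{Q}[e_1,e_2]/(e_1(m),e_2(m)),$$ graded by $\deg e_1=1$, $\deg e_2=2$. Put $d=3(m-1)$ and $h_i=\dim_{\mathbb{Q}}A_i$. The algebra $A$ is graded Artinian Gorenstein of socle degree $d$: it is finite dimensional, $A=\bigoplus_{i=0}^dA_i$, and there is a linear isomorphism $\int_A\colon A_d\to\mathbb{Q}$ (an orientation), which we normalize by $\int_A e_1^{m-1}e_2^{m-1}=1$, such that the pairings $A_i\times A_{d-i}\to\mathbb{Q}$, $(\alpha,\beta)\mapsto\int_A\alpha\beta$, are non-degenerate for $0\le i\le\lfloor d/2\rfloor$. For $\ell\in A_1$ and $0\le r\le\lfloor d/2\rfloor$, define the following properties. * $\mathrm{SLP}_r$: the map $\times\ell^{d-2i}\colon A_i\to A_{d-i}$ is an isomorphism for all $0\le i\le r$. * $\mathrm{HLP}$: the map $\times\ell^{d-2i}\colon A_i\to A_{d-i}$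 has rank $\min\{h_i,h_{i+1},\ldots,h_{d-i}\}$ for all $0\le i\le\lfloor d/2\rfloor$. * complex $\mathrm{HRR}_r$: for all $0\le i\le r$, the primitive subspace $P_i=\ker(\times\ell^{d-2i+1}\colon A_i\to A_{d-i+1})$ is zero if $i$ is odd, and $(\sqrt{-1})^i\int_A\ell^{d-2i}\alpha^2>0$ for all nonzero $\alpha\in P_i$. We say that $A$ has one of these properties if some $\ell\in A_1$ has it. $\mathrm{SLP}$ and complex $\mathrm{HRR}$ without index mean $r=\lfloor d/2\rfloor$. Then: 1. If $m$ is even, $A(m,2)$ satisfies $\mathrm{SLP}$. If $m$ is odd, $A(m,2)$ satisfies $\mathrm{SLP}_r$ for $r=\max(m-2,0)$. 2. $A(m,2)$ satisfies $\mathrm{HLP}$ for all $m\ge 1$. 3. If $m$ is even, $A(m,2)$ satisfies complex $\mathrm{HRR}$. If $m$ is odd, $A(m,2)$ satisfies complex $\mathrm{HRR}_r$ for $r=\max(m-2,0)$. -/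

import Mathlib

noncomputable section

namespace Almkvist

open MvPolynomial

/-! The algebras `A(m,n)`. -/

/-- The subalgebra `ℚ[e₁,…,eₙ] ⊆ ℚ[x₁,…,xₙ]` generated by the elementary symmetric polynomials. -/
abbrev esymmSubalgebra (n : ℕ) : Subalgebra ℚ (MvPolynomial (Fin n) ℚ) :=
  Algebra.adjoin ℚ (Set.range fun i : Fin n => esymm (Fin n) ℚ (i + 1))

/-- `eᵢ(m) = eᵢ(x₁ᵐ,…,xₙᵐ)`; `expand m` is the substitution `xⱼ ↦ xⱼᵐ`. -/
def powEsymm (m n i : ℕ) : MvPolynomial (Fin n) ℚ :=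
  expand m (esymm (Fin n) ℚ i)

theorem mem_esymmSubalgebra_of_isSymmetric {n : ℕ} {p : MvPolynomial (Fin n) ℚ}
    (hp : p.IsSymmetric) : p ∈ esymmSubalgebra n := by
  obtain ⟨q, hq⟩ := esymmAlgHom_surjective (σ := Fin n) ℚ (n := n) (by simp) ⟨p, hp⟩
  have h1 : p = aeval (fun i : Fin n => esymm (Fin n) ℚ (i + 1)) q := by
    rw [← esymmAlgHom_apply, hq]
  rw [h1, esymmSubalgebra, Algebra.adjoin_range_eq_range_aeval]
  exact ⟨q, rfl⟩

theorem powEsymm_mem (m n i : ℕ) : powEsymm m n i ∈ esymmSubalgebra n := by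
  apply mem_esymmSubalgebra_of_isSymmetric
  intro σ
  rw [powEsymm, rename_expand, esymm_isSymmetric (Fin n) ℚ i σ]

/-- The ideal `(e₁(m),…,eₙ(m))` of `ℚ[e₁,…,eₙ]`. -/
def powEsymmIdeal (m n : ℕ) : Ideal (esymmSubalgebra n) :=
  Ideal.span (Set.range fun i : Fin n =>
    (⟨powEsymm m n (i + 1), powEsymm_mem m n (i + 1)⟩ : esymmSubalgebra n))

/-- `A(m,n) = ℚ[e₁,…,eₙ] / (e₁(m),…,eₙ(m))`. -/
def A (m n : ℕ) : Type := esymmSubalgebra n ⧸ powEsymmIdeal m n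

instance (m n : ℕ) : CommRing (A m n) :=
  inferInstanceAs (CommRing (esymmSubalgebra n ⧸ powEsymmIdeal m n))

instance (m n : ℕ) : Algebra ℚ (A m n) :=
  inferInstanceAs (Algebra ℚ (esymmSubalgebra n ⧸ powEsymmIdeal m n))

/-- The quotient map `ℚ[e₁,…,eₙ] → A(m,n)`. -/
def toA (m n : ℕ) : esymmSubalgebra n →ₐ[ℚ] A m n :=
  Ideal.Quotient.mkₐ ℚ (powEsymmIdeal m n)

/-- The degree `k` component of `A(m,n)`: the classes of the elements of `ℚ[e₁,…,eₙ]` that are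
homogeneous of degree `k` as polynomials in `x₁,…,xₙ` (so that `eᵢ` has degree `i`). -/
def grade (m n k : ℕ) : Submodule ℚ (A m n) :=
  ((homogeneousSubmodule (Fin n) ℚ k).comap (esymmSubalgebra n).val.toLinearMap).map
    (toA m n).toLinearMap

/-- The class of `eᵢ`, `1 ≤ i ≤ n`, in `A(m,n)`; the index `i : Fin n` stands for `e_{i+1}`. -/
def e (m n : ℕ) (i : Fin n) : A m n :=
  toA m n ⟨esymm (Fin n) ℚ (i + 1), Algebra.subset_adjoin ⟨i, rfl⟩⟩

/-! Lefschetz properties and Hodge-Riemann relations of a graded `ℚ`-algebra `B = ⨁ₖ 𝒜 k`. -/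

variable {B : Type*} [CommRing B] [Algebra ℚ B]

/-- `B = ⨁ₖ 𝒜 k` is a graded Artinian Gorenstein `ℚ`-algebra of socle degree `d`, oriented by
`φ`. The orientation is an isomorphism `𝒜 d ≃ ℚ`; it is extended by zero to the other degrees. -/
structure IsOrientedAG (𝒜 : ℕ → Submodule ℚ B) (d : ℕ) (φ : B →ₗ[ℚ] ℚ) : Prop where
  finite : Module.Finite ℚ B
  gradedMonoid : SetLike.GradedMonoid 𝒜
  isInternal : DirectSum.IsInternal 𝒜
  eq_bot : ∀ k, d < k → 𝒜 k = ⊥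
  orientation : Set.BijOn φ (𝒜 d : Set B) Set.univ
  orientation_of_ne : ∀ k, k ≠ d → ∀ α ∈ 𝒜 k, φ α = 0
  nondegenerate_left : ∀ i ≤ d / 2, ∀ α ∈ 𝒜 i, (∀ β ∈ 𝒜 (d - i), φ (α * β) = 0) → α = 0
  nondegenerate_right : ∀ i ≤ d / 2, ∀ β ∈ 𝒜 (d - i), (∀ α ∈ 𝒜 i, φ (α * β) = 0) → β = 0

/-- `(B, ℓ)` has the strong Lefschetz property up to degree `r` (meant for `r ≤ d / 2`):
`×ℓ^(d-2i) : 𝒜 i → 𝒜 (d-i)` is an isomorphism for all `0 ≤ i ≤ r`. -/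
def IsSL (𝒜 : ℕ → Submodule ℚ B) (d : ℕ) (ℓ : B) (r : ℕ) : Prop :=
  ∀ i ≤ r, Set.BijOn (fun α => ℓ ^ (d - 2 * i) * α) (𝒜 i : Set B) (𝒜 (d - i) : Set B)

/-- `(B, ℓ)` has the Lefschetz property with respect to its Hilbert function: for all
`0 ≤ i ≤ d / 2` the rank of `×ℓ^(d-2i) : 𝒜 i → 𝒜 (d-i)` is `min {h_i, …, h_{d-i}}`. -/
def IsHLP (𝒜 : ℕ → Submodule ℚ B) (d : ℕ) (ℓ : B) : Prop :=
  ∀ i ≤ d / 2, IsLeast ((fun j => Module.finrank ℚ (𝒜 j)) '' Set.Icc i (d - i))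
    (Module.finrank ℚ ((𝒜 i).map (LinearMap.mulLeft ℚ (ℓ ^ (d - 2 * i)))))

/-- The `i`-th primitive subspace `ker (×ℓ^(d-2i+1) : 𝒜 i → 𝒜 (d-i+1))`. -/
def primitive (𝒜 : ℕ → Submodule ℚ B) (d : ℕ) (ℓ : B) (i : ℕ) : Submodule ℚ B :=
  𝒜 i ⊓ LinearMap.ker (LinearMap.mulLeft ℚ (ℓ ^ (d - 2 * i + 1)))

/-- `((B, φ), ℓ)` satisfies the complex Hodge-Riemann relations up to degree `r` (meant for
`r ≤ d / 2`): for `0 ≤ i ≤ r`, the primitive subspace `P_i` vanishes if `i` is odd, and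
`(√-1)^i φ(ℓ^(d-2i) α²) > 0` for all `0 ≠ α ∈ P_i` if `i` is even, where
`(√-1)^i = (-1)^(i/2)`. -/
def IsComplexHRR (𝒜 : ℕ → Submodule ℚ B) (d : ℕ) (φ : B →ₗ[ℚ] ℚ) (ℓ : B) (r : ℕ) : Prop :=
  ∀ i ≤ r, (Odd i → primitive 𝒜 d ℓ i = ⊥) ∧
    (Even i → ∀ α ∈ primitive 𝒜 d ℓ i, α ≠ 0 →
      0 < (-1 : ℚ) ^ (i / 2) * φ (ℓ ^ (d - 2 * i) * α ^ 2))

/-- SLP up to degree `r` for the algebra: some linear form has it. -/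
def HasSLUpTo (𝒜 : ℕ → Submodule ℚ B) (d r : ℕ) : Prop :=
  ∃ ℓ ∈ 𝒜 1, IsSL 𝒜 d ℓ r

/-- SLP for the algebra. -/
def HasSLP (𝒜 : ℕ → Submodule ℚ B) (d : ℕ) : Prop := HasSLUpTo 𝒜 d (d / 2)

/-- HLP for the algebra. -/
def HasHLP (𝒜 : ℕ → Submodule ℚ B) (d : ℕ) : Prop :=
  ∃ ℓ ∈ 𝒜 1, IsHLP 𝒜 d ℓ

/-- Complex HRR up to degree `r` for the oriented algebra. -/
def HasComplexHRRUpTo (𝒜 : ℕ → Submodule ℚ B) (d : ℕ) (φ : B →ₗ[ℚ] ℚ) (r : ℕ) : Prop :=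
  ∃ ℓ ∈ 𝒜 1, IsComplexHRR 𝒜 d φ ℓ r

/-- Complex HRR for the oriented algebra. -/
def HasComplexHRR (𝒜 : ℕ → Submodule ℚ B) (d : ℕ) (φ : B →ₗ[ℚ] ℚ) : Prop :=
  HasComplexHRRUpTo 𝒜 d φ (d / 2)

end Almkvist

end

/-! ### Minors under bidiagonal operators. -/

noncomputable section

namespace Almkvist

open Matrix

/-! Put x = e₁, y = e₂, d = 3(m-1) and take ℓ = x. Everything rests on the Toeplitz matrices T_s
with entries ∫ x^(d-2n) y^n, n = r+s-c: up to reversing columns, T_s is the Gram matrix of (α, β) ↦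
∫ x^(d-4s) αβ in degree 2s. The key fact is det T_s > 0 for 2s ≤ m-2 (`det_toeplitz_pos`).

In terms of the elements y^b h_j, with h_j complete symmetric, multiplication by x reads x h_j =
h_(j+1) + y h_(j-1), and x h_(m-1) = 2 y h_(m-2), since the power sum h_m - y h_(m-2) vanishes. So x
acts by bidiagonal matrices with nonnegative entries, which preserve nonnegativity of minors; one
minor is tracked and stays positive. T_s is the matrix of that minor times a unitriangular matrix.

Nonsingularity of T_s gives injectivity in even degrees up to m-2, and odd degrees are x times even
ones. Cramer's rule with det T_(s-1) and det T_s gives the sign (-1)^s on primitive classes. Above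
degree m-2, if m is even or i is odd, A_i is no larger than A_(m-2), hence is its image under a
power of x, and no new primitive classes appear. If m is odd and i is even, the rank below the
middle degree is h_(i+1), which still gives HLP. The orientation is a residue, and duality follows
from a triangular pairing of monomials. -/

/-- The minor of the rows `x r : ℕ → ℚ` in the columns `f`. -/
def colMinor {k : ℕ} (x : Fin k → ℕ → ℚ) (f : Fin k → ℕ) : ℚ :=
  (Matrix.of fun c r => x r (f c)).det

/-- All minors in increasing columns are nonnegative. -/
def NonnegMinors {k : ℕ} (x : Fin k → ℕ → ℚ) : Prop :=
  ∀ f : Fin k → ℕ, StrictMono f → 0 ≤ colMinor x f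

/-- If the columns are not strictly increasing, one is repeated and the minor vanishes. -/
theorem NonnegMinors.of_monotone {k : ℕ} {x : Fin k → ℕ → ℚ} (hx : NonnegMinors x)
    {f : Fin k → ℕ} (hf : Monotone f) : 0 ≤ colMinor x f := by
  by_cases h : Function.Injective f
  · exact hx f (hf.strictMono_of_injective h)
  · simp only [Function.Injective, not_forall] at h
    obtain ⟨i, j, hij, hne⟩ := h
    refine le_of_eq (Matrix.det_zero_of_row_eq hne ?_).symm
    ext r
    simp [hij]

/-- The action of a lower bidiagonal matrix on a sequence. -/
def bidiag (α β : ℕ → ℚ) (v : ℕ → ℚ) (b : ℕ) : ℚ := α b * v b + β b * v (b - 1)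

/-- The choice of columns `f c` for `c ∈ S` and `f c - 1` for `c ∉ S`. -/
def shiftCols {k : ℕ} (f : Fin k → ℕ) (S : Finset (Fin k)) (c : Fin k) : ℕ :=
  if c ∈ S then f c else f c - 1

/-- Cauchy–Binet for a bidiagonal matrix, by multilinearity: each new column combines the old
columns `f c` and `f c - 1`. -/
theorem colMinor_bidiag {k : ℕ} (α β : ℕ → ℚ) (x : Fin k → ℕ → ℚ) (f : Fin k → ℕ) :
    colMinor (fun r => bidiag α β (x r)) f =
      ∑ S : Finset (Fin k), (∏ c, if c ∈ S then α (f c) else β (f c)) *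
        colMinor x (shiftCols f S) := by
  have h1 : colMinor (fun r => bidiag α β (x r)) f =
      Matrix.detRowAlternating ((fun c r => α (f c) * x r (f c)) +
        (fun c r => β (f c) * x r (f c - 1)) : Fin k → Fin k → ℚ) := rfl
  rw [h1, ← AlternatingMap.coe_multilinearMap, MultilinearMap.map_add_univ]
  refine Finset.sum_congr rfl fun S _ => ?_
  have h2 : S.piecewise (fun c r => α (f c) * x r (f c))
      (fun c r => β (f c) * x r (f c - 1)) =
      fun c => (if c ∈ S then α (f c) else β (f c)) • (fun r => x r (shiftCols f S c)) := by
    ext c r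
    by_cases hc : c ∈ S <;> simp [hc, shiftCols]
  rw [h2, MultilinearMap.map_smul_univ]
  rfl

/-- Strictly increasing columns, each lowered by at most one, remain weakly increasing, also under
truncation at 0. Hence no reordering sign arises. -/
theorem bidiag_term_nonneg {k : ℕ} {α β : ℕ → ℚ} (hα : ∀ b, 0 ≤ α b) (hβ : ∀ b, 0 ≤ β b)
    {x : Fin k → ℕ → ℚ} (hx : NonnegMinors x) {f : Fin k → ℕ}
    (hf : StrictMono f) (S : Finset (Fin k)) :
    0 ≤ (∏ c, if c ∈ S then α (f c) else β (f c)) * colMinor x (shiftCols f S) := by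
  refine mul_nonneg (Finset.prod_nonneg fun c _ => by split_ifs <;> simp [hα, hβ]) ?_
  refine hx.of_monotone fun c c' hcc => ?_
  rcases hcc.eq_or_lt with rfl | hlt
  · exact le_rfl
  · have := hf hlt
    unfold shiftCols
    split_ifs <;> omega

theorem NonnegMinors.bidiag {k : ℕ} {α β : ℕ → ℚ} (hα : ∀ b, 0 ≤ α b) (hβ : ∀ b, 0 ≤ β b)
    {x : Fin k → ℕ → ℚ} (hx : NonnegMinors x) :
    NonnegMinors fun r => bidiag α β (x r) := by
  intro f hf
  rw [colMinor_bidiag]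
  exact Finset.sum_nonneg fun S _ => bidiag_term_nonneg hα hβ hx hf S

theorem NonnegMinors.colMinor_bidiag_pos {k : ℕ} {α β : ℕ → ℚ} (hα : ∀ b, 0 ≤ α b)
    (hβ : ∀ b, 0 ≤ β b) {x : Fin k → ℕ → ℚ} (hx : NonnegMinors x)
    {f : Fin k → ℕ} (hf : StrictMono f) (S : Finset (Fin k))
    (hS : ∀ c, 0 < if c ∈ S then α (f c) else β (f c)) (hpos : 0 < colMinor x (shiftCols f S)) :
    0 < colMinor (fun r => Almkvist.bidiag α β (x r)) f := by
  rw [colMinor_bidiag]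
  refine Finset.sum_pos' (fun S _ => bidiag_term_nonneg hα hβ hx hf S) ⟨S, by simp, ?_⟩
  exact mul_pos (Finset.prod_pos fun c _ => hS c) hpos

end Almkvist

end

/-! ### Coordinates of monomials in the elements y^b h_j. -/

noncomputable section

namespace Almkvist

open Matrix

/-- The complete symmetric polynomials of two variables `x₁, x₂`, as functions of
`x = x₁ + x₂` and `y = x₁x₂`. -/
def hsym {R : Type*} [CommRing R] (x y : R) : ℕ → R
  | 0 => 1
  | 1 => x
  | n + 2 => x * hsym x y (n + 1) - y * hsym x y n

/-- A `ℚ`-algebra generated by `x` and `y`, with the relations of `A(m,2)` and a functional that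
behaves like its orientation. -/
structure IsTwoGen {B : Type*} [CommRing B] [Algebra ℚ B] (m : ℕ) (x y : B) (φ : B →ₗ[ℚ] ℚ) :
    Prop where
  pos : 1 ≤ m
  span_eq_top : Submodule.span ℚ (Set.range fun p : ℕ × ℕ => x ^ p.1 * y ^ p.2) = ⊤
  pow_eq_zero : y ^ m = 0
  eq_zero_of_one : m = 1 → x = 0
  hsym_eq : 2 ≤ m → hsym x y m = y * hsym x y (m - 2)
  map_top : φ (x ^ (m - 1) * y ^ (m - 1)) = 1
  map_eq_zero : ∀ a b, a + 2 * b ≠ 3 * (m - 1) → φ (x ^ a * y ^ b) = 0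

/-- The weight of the step `y ^ b * h_(t-2b) ↦ y ^ b * h_(t+1-2b)` of multiplication by `x`. -/
def upWeight (m t b : ℕ) : ℚ := if t + 1 < 2 * b + m then 1 else 0

/-- The weight of the step `y ^ (b-1) * h_(t-2(b-1)) ↦ y ^ b * h_(t+1-2b)` of multiplication
by `x`. -/
def downWeight (m t b : ℕ) : ℚ :=
  if b = 0 ∨ t + 2 ≤ 2 * b then 0 else if t + 3 = 2 * b + m then 2 else 1

theorem upWeight_nonneg (m t b : ℕ) : 0 ≤ upWeight m t b := by
  unfold upWeight; split_ifs <;> norm_num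

theorem downWeight_nonneg (m t b : ℕ) : 0 ≤ downWeight m t b := by
  unfold downWeight; split_ifs <;> norm_num

/-- The coordinates of `x ^ n * y ^ r` with respect to the elements `y ^ b * h_(2r+n-2b)`. -/
def coord (m r : ℕ) : ℕ → ℕ → ℚ
  | 0 => Pi.single r 1
  | n + 1 => bidiag (upWeight m (2 * r + n)) (downWeight m (2 * r + n)) (coord m r n)

/-- The weights vanish where a step would leave the range 0 ≤ j < m of the factor h_j. No bound b <
m is imposed; terms with b ≥ m disappear later through y^m = 0. -/
theorem coord_support {m : ℕ} (hm : 2 ≤ m) (r n b : ℕ) (h : coord m r n b ≠ 0) :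
    r ≤ b ∧ 2 * b ≤ 2 * r + n ∧ 2 * r + n < 2 * b + m := by
  induction n generalizing b with
  | zero =>
    have : b = r := by
      by_contra hne
      exact h (Pi.single_eq_of_ne hne _)
    omega
  | succ n ih =>
    by_cases h1 : upWeight m (2 * r + n) b * coord m r n b = 0
    · have h2 : downWeight m (2 * r + n) b * coord m r n (b - 1) ≠ 0 := fun h2 =>
        h (by simp only [coord, bidiag]; rw [h1, h2, add_zero])
      have h3 := ih _ (right_ne_zero_of_mul h2)
      have h4 := left_ne_zero_of_mul h2
      unfold downWeight at h4
      have h5 : ¬(b = 0 ∨ 2 * r + n + 2 ≤ 2 * b) := fun h5 => h4 (if_pos h5)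
      omega
    · have h3 := ih _ (right_ne_zero_of_mul h1)
      have h4 := left_ne_zero_of_mul h1
      unfold upWeight at h4
      have h5 : 2 * r + n + 1 < 2 * b + m := by
        by_contra h5
        exact h4 (if_neg h5)
      omega

theorem coord_self {m : ℕ} (hm : 2 ≤ m) (r n : ℕ) (hn : n < m) : coord m r n r = 1 := by
  induction n with
  | zero => exact Pi.single_eq_same _ _
  | succ n ih =>
    have h1 : downWeight m (2 * r + n) r * coord m r n (r - 1) = 0 := by
      rcases Nat.eq_zero_or_pos r with h0 | h0
      · rw [downWeight, if_pos (Or.inl h0), zero_mul]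
      · rw [mul_eq_zero]
        right
        by_contra h
        have := coord_support hm _ _ _ h
        omega
    have h2 : upWeight m (2 * r + n) r = 1 := if_pos (by omega)
    simp only [coord, bidiag]
    rw [h1, h2, ih (by omega)]
    norm_num

/-- The coordinates of `x ^ (2s+q-2r) * y ^ r` for `r = 0, …, s`. -/
def coordRows (m s q : ℕ) (r : Fin (s + 1)) : ℕ → ℚ := coord m r (2 * (s - r) + q)

theorem coordRows_succ (m s q : ℕ) : coordRows m s (q + 1) = fun r =>
    bidiag (upWeight m (2 * s + q)) (downWeight m (2 * s + q)) (coordRows m s q r) := by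
  funext r
  have : 2 * (r : ℕ) + (2 * (s - r) + q) = 2 * s + q := by omega
  rw [coordRows, ← add_assoc, coord, this]
  rfl

theorem colMinor_coordRows_zero {m s : ℕ} (hm : 2 * s + 2 ≤ m) :
    colMinor (coordRows m s 0) (fun c => (c : ℕ)) = 1 := by
  rw [colMinor, Matrix.det_of_isLowerTriangular]
  · refine Finset.prod_eq_one fun r _ => ?_
    exact coord_self (by omega) _ _ (by omega)
  · intro c r hcr
    by_contra h
    have h1 := coord_support (by omega) _ _ _ h
    have h2 : c < r := hcr
    omega

/-- In degree 2s all coordinates lie in columns 0, …, s, so only the full minor on these columns can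
be nonzero, and it is unitriangular. -/
theorem nonnegMinors_coordRows_zero {m s : ℕ} (hm : 2 * s + 2 ≤ m) :
    NonnegMinors (coordRows m s 0) := by
  intro f hf
  by_cases hlast : f (Fin.last s) ≤ s
  · have hle : ∀ c, f c < s + 1 := fun c =>
      Nat.lt_succ_of_le ((hf.monotone (Fin.le_last c)).trans hlast)
    let g : Fin (s + 1) → Fin (s + 1) := fun c => ⟨f c, hle c⟩
    have hg : StrictMono g := fun a b hab => hf hab
    have hfid : f = fun c : Fin (s + 1) => (c : ℕ) := by
      funext c
      exact congrArg Fin.val (le_antisymm hg.apply_le hg.le_apply : g c = c)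
    rw [hfid, colMinor_coordRows_zero hm]
    exact zero_le_one
  · refine le_of_eq (Matrix.det_eq_zero_of_row_eq_zero (Fin.last s) fun r => ?_).symm
    by_contra h
    have h1 := coord_support (by omega) _ _ _ h
    omega

theorem nonnegMinors_coordRows {m s : ℕ} (hm : 2 * s + 2 ≤ m) (q : ℕ) :
    NonnegMinors (coordRows m s q) := by
  induction q with
  | zero => exact nonnegMinors_coordRows_zero hm
  | succ q ih =>
    rw [coordRows_succ]
    exact ih.bidiag (upWeight_nonneg m _) (downWeight_nonneg m _)

theorem strictMono_add_val (s q : ℕ) : StrictMono fun c : Fin (s + 1) => q + (c : ℕ) :=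
  fun _ _ hab => Nat.add_lt_add_left hab q

/-- The positive term is the one in which every column stays in place; the bound on n makes all its
weights 1. -/
theorem colMinor_coordRows_up {m s : ℕ} (hm : 2 * s + 2 ≤ m) {n q : ℕ}
    (hn : 2 * s + n + 1 < m) (h : 0 < colMinor (coordRows m s (2 * q + n)) fun c => q + (c : ℕ)) :
    0 < colMinor (coordRows m s (2 * q + n + 1)) fun c => q + (c : ℕ) := by
  rw [coordRows_succ]
  refine (nonnegMinors_coordRows hm _).colMinor_bidiag_pos (upWeight_nonneg m _)
    (downWeight_nonneg m _) (strictMono_add_val s q) Finset.univ (fun c => ?_) ?_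
  · rw [if_pos (Finset.mem_univ c), upWeight, if_pos (by omega)]
    exact one_pos
  · convert h using 2
    funext c
    exact if_pos (Finset.mem_univ _)

/-- The positive term is the one in which every column comes from its left neighbour. -/
theorem colMinor_coordRows_down {m s : ℕ} (hm : 2 * s + 2 ≤ m) {q : ℕ}
    (h : 0 < colMinor (coordRows m s (2 * q + 1)) fun c => q + (c : ℕ)) :
    0 < colMinor (coordRows m s (2 * (q + 1))) fun c => q + 1 + (c : ℕ) := by
  rw [show 2 * (q + 1) = 2 * q + 1 + 1 by ring, coordRows_succ]
  refine (nonnegMinors_coordRows hm _).colMinor_bidiag_pos (upWeight_nonneg m _)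
    (downWeight_nonneg m _) (strictMono_add_val s (q + 1)) ∅ (fun c => ?_) ?_
  · rw [if_neg (Finset.notMem_empty c), downWeight, if_neg (by omega)]
    split_ifs <;> norm_num
  · convert h using 2
    funext c
    have h1 : shiftCols (fun c : Fin (s + 1) => q + 1 + (c : ℕ)) ∅ c = q + 1 + c - 1 := if_neg (by simp)
    omega

/-- An up step followed by a down step raises q by one; n further up steps then reach the required
degree. -/
theorem colMinor_coordRows_pos {m s : ℕ} (hm : 2 * s + 2 ≤ m) (q n : ℕ) (hn : 2 * s + n < m) :
    0 < colMinor (coordRows m s (2 * q + n)) fun c => q + (c : ℕ) := by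
  have h0 : 0 < colMinor (coordRows m s (2 * q)) fun c => q + (c : ℕ) := by
    induction q with
    | zero => simpa using (colMinor_coordRows_zero hm).symm ▸ one_pos
    | succ q ih => exact colMinor_coordRows_down hm (colMinor_coordRows_up hm (n := 0) (by omega) ih)
  induction n with
  | zero => exact h0
  | succ n ih => exact colMinor_coordRows_up hm hn (ih (by omega))

namespace IsTwoGen

variable {B : Type*} [CommRing B] [Algebra ℚ B] {m : ℕ} {x y : B} {φ : B →ₗ[ℚ] ℚ}

theorem pow_eq_zero_of_le (H : IsTwoGen m x y φ) {b : ℕ} (hb : m ≤ b) : y ^ b = 0 :=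
  _root_.pow_eq_zero_of_le hb H.pow_eq_zero

/-- With j = t-2b this is x h_j = h_(j+1) + y h_(j-1). For j = m-1 the term h_m equals y h_(m-2) and
merges with the other one, whence the weight 2; for j = 0 the weight 0 discards the truncated index.
-/
theorem mul_hsym (H : IsTwoGen m x y φ) (hm : 2 ≤ m) {t b : ℕ} (h1 : 2 * b ≤ t)
    (h2 : t < 2 * b + m) :
    x * (y ^ b * hsym x y (t - 2 * b)) =
      upWeight m t b • (y ^ b * hsym x y (t + 1 - 2 * b)) +
        downWeight m t (b + 1) • (y ^ (b + 1) * hsym x y (t + 1 - 2 * (b + 1))) := by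
  obtain ⟨j, rfl⟩ := Nat.exists_eq_add_of_le h1
  have e1 : 2 * b + j - 2 * b = j := by omega
  have e2 : 2 * b + j + 1 - 2 * b = j + 1 := by omega
  have e3 : 2 * b + j + 1 - 2 * (b + 1) = j - 1 := by omega
  rw [e1, e2, e3, upWeight, downWeight]
  rcases Nat.eq_zero_or_pos j with rfl | hj
  · rw [if_pos (by omega), if_pos (by omega)]
    simp only [hsym, one_smul, zero_smul, add_zero]
    ring
  · obtain ⟨j, rfl⟩ : ∃ k, j = k + 1 := ⟨j - 1, by omega⟩
    rw [if_neg (c := b + 1 = 0 ∨ _) (by omega)]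
    have h3 : x * hsym x y (j + 1) = hsym x y (j + 1 + 1) + y * hsym x y j := by
      simp only [hsym]; ring
    by_cases hjm : j + 2 = m
    · rw [if_neg (by omega), if_pos (by omega), zero_smul, zero_add, mul_left_comm, h3,
        show j + 1 + 1 = m by omega, H.hsym_eq hm, show m - 2 = j by omega,
        Nat.add_sub_cancel, two_smul]
      ring
    · rw [if_pos (by omega), if_neg (by omega), one_smul, one_smul, mul_left_comm, h3,
        Nat.add_sub_cancel]
      ring

theorem pow_mul_pow_eq_sum (H : IsTwoGen m x y φ) (hm : 2 ≤ m) (r n : ℕ) :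
    x ^ n * y ^ r = ∑ b ∈ Finset.range (2 * r + n + 1),
      coord m r n b • (y ^ b * hsym x y (2 * r + n - 2 * b)) := by
  induction n with
  | zero =>
    rw [Finset.sum_eq_single_of_mem r (Finset.mem_range.2 (by omega))]
    · simp [coord, hsym]
    · intro b _ hb
      rw [coord, Pi.single_eq_of_ne hb, zero_smul]
  | succ n ih =>
    rw [pow_succ', mul_assoc, ih, Finset.mul_sum]
    simp only [coord, bidiag, add_smul, Finset.sum_add_distrib]
    have hz : ∀ b, 2 * r + n < 2 * b → coord m r n b = 0 := fun b hb => by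
      by_contra h
      have := coord_support hm _ _ _ h
      omega
    have h0 : downWeight m (2 * r + n) 0 = 0 := if_pos (Or.inl rfl)
    rw [← add_assoc, Finset.sum_range_succ (n := 2 * r + n + 1), hz (2 * r + n + 1) (by omega),
      Finset.sum_range_succ' (n := 2 * r + n + 1), h0]
    simp only [mul_zero, zero_mul, zero_smul, add_zero, Nat.add_sub_cancel]
    rw [← Finset.sum_add_distrib]
    refine Finset.sum_congr rfl fun b _ => ?_
    by_cases hb : coord m r n b = 0
    · simp [hb]
    · have hs := coord_support hm _ _ _ hb
      rw [mul_smul_comm, H.mul_hsym hm hs.2.1 hs.2.2, smul_add, smul_smul, smul_smul,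
        mul_comm (coord m r n b), mul_comm (coord m r n b)]

/-- Since y^(m-1) annihilates y, the recursion for h_j reduces to multiplication by x. -/
theorem pow_mul_hsym (H : IsTwoGen m x y φ) (j : ℕ) :
    y ^ (m - 1) * hsym x y j = y ^ (m - 1) * x ^ j := by
  have hy : y ^ (m - 1) * y = 0 := by
    rw [← pow_succ, Nat.sub_add_cancel H.pos, H.pow_eq_zero]
  induction j using Nat.twoStepInduction with
  | zero => simp [hsym]
  | one => simp [hsym]
  | more j _ ih =>
    rw [hsym, mul_sub, ← mul_assoc _ y, hy, zero_mul, sub_zero, mul_left_comm, ih]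
    ring

end IsTwoGen

/-! ### The Toeplitz matrices and their determinants. -/

/-- The numbers `∫ x ^ (d-2n) * y ^ n`, where `d = 3(m-1)`. -/
def moment {B : Type*} [CommRing B] [Algebra ℚ B] (m : ℕ) (x y : B) (φ : B →ₗ[ℚ] ℚ) (n : ℕ) : ℚ :=
  φ (x ^ (3 * (m - 1) - 2 * n) * y ^ n)

/-- The Gram matrix of `(α, β) ↦ ∫ x ^ (d-4s) * α * β` on the monomials of degree `2s`, with its
columns reversed. -/
def toeplitz {B : Type*} [CommRing B] [Algebra ℚ B] (m : ℕ) (x y : B) (φ : B →ₗ[ℚ] ℚ) (s : ℕ) :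
    Matrix (Fin (s + 1)) (Fin (s + 1)) ℚ :=
  Matrix.of fun r c => moment m x y φ (r + (s - c))

namespace IsTwoGen

variable {B : Type*} [CommRing B] [Algebra ℚ B] {m : ℕ} {x y : B} {φ : B →ₗ[ℚ] ℚ}

/-- Expand the row monomial in the y^b h_j. Only m-1-s ≤ b < m survives: smaller b lie outside the
support, larger b are killed by y^m = 0. -/
theorem toeplitz_eq_mul (H : IsTwoGen m x y φ) {s : ℕ} (hm : 2 * s + 2 ≤ m) :
    toeplitz m x y φ s =
      (Matrix.of fun c r : Fin (s + 1) =>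
        coordRows m s (2 * (m - 1 - s) + (m - 1 - 2 * s)) r (m - 1 - s + c))ᵀ *
      Matrix.of fun c' c : Fin (s + 1) => φ (y ^ (m - 1 - s + c' : ℕ) *
        hsym x y (m - 1 - 2 * s + 2 * (s - c')) * (x ^ (2 * c : ℕ) * y ^ (s - c : ℕ))) := by
  ext r c
  set n := 2 * (s - r) + (2 * (m - 1 - s) + (m - 1 - 2 * s)) with hn
  have hr := r.isLt
  have hc := c.isLt
  have ht : 2 * (r : ℕ) + n = 3 * (m - 1) - 2 * s := by omega
  have h1 : x ^ (3 * (m - 1) - 2 * (r + (s - c))) * y ^ (r + (s - c) : ℕ) =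
      x ^ n * y ^ (r : ℕ) * (x ^ (2 * c : ℕ) * y ^ (s - c : ℕ)) := by
    rw [show 3 * (m - 1) - 2 * (r + (s - c)) = n + 2 * c by omega]
    ring
  rw [toeplitz, Matrix.of_apply, moment, h1, H.pow_mul_pow_eq_sum (by omega), Finset.sum_mul,
    map_sum, Matrix.mul_apply]
  simp only [Matrix.transpose_apply, Matrix.of_apply, smul_mul_assoc, map_smul, smul_eq_mul]
  rw [← Finset.sum_subset (s₁ := Finset.Ico (m - 1 - s) m), Finset.sum_Ico_eq_sum_range,
    show m - (m - 1 - s) = s + 1 by omega, Finset.sum_range]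
  · refine Finset.sum_congr rfl fun c' _ => ?_
    have hc' := c'.isLt
    rw [show 2 * (r : ℕ) + n - 2 * (m - 1 - s + c') = m - 1 - 2 * s + 2 * (s - c') by omega]
    rfl
  · intro b hb
    rw [Finset.mem_Ico] at hb
    rw [Finset.mem_range]
    omega
  · intro b _ hb
    rw [Finset.mem_Ico] at hb
    by_cases hbm : m ≤ b
    · rw [H.pow_eq_zero_of_le hbm, zero_mul, zero_mul, map_zero, mul_zero]
    · have : coord m r n b = 0 := by
        by_contra h
        have := coord_support (by omega) _ _ _ h
        omega
      rw [this, zero_mul]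

theorem det_toeplitz_pos (H : IsTwoGen m x y φ) {s : ℕ} (hs : 2 * s ≤ m - 2) :
    0 < (toeplitz m x y φ s).det := by
  rcases H.pos.eq_or_lt with rfl | hm2
  · obtain rfl : s = 0 := by omega
    have := H.map_top
    simp only [toeplitz, moment] at this ⊢
    simp [Matrix.det_unique] at this ⊢
    simp [this]
  · have hm : 2 * s + 2 ≤ m := by omega
    rw [H.toeplitz_eq_mul hm, Matrix.det_mul, Matrix.det_transpose]
    refine mul_pos (colMinor_coordRows_pos hm _ _ (by omega)) ?_
    -- For c < c' the exponent of y is at least m, and the diagonal entries are ∫ x^(m-1) y^(m-1) =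
    -- 1.
    rw [Matrix.det_of_isUpperTriangular]
    · refine Finset.prod_pos fun c _ => ?_
      have hc := c.isLt
      rw [Matrix.of_apply]
      have : y ^ (m - 1 - s + c : ℕ) * hsym x y (m - 1 - 2 * s + 2 * (s - c)) *
          (x ^ (2 * c : ℕ) * y ^ (s - c : ℕ)) =
          y ^ (m - 1) * hsym x y (m - 1 - 2 * s + 2 * (s - c)) * x ^ (2 * c : ℕ) := by
        have h : y ^ (m - 1) = y ^ (m - 1 - s + c : ℕ) * y ^ (s - c : ℕ) := by
          rw [← pow_add]
          congr 1
          omega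
        rw [h]
        ring
      rw [this, H.pow_mul_hsym, mul_assoc, ← pow_add,
        show m - 1 - 2 * s + 2 * (s - c) + 2 * c = m - 1 by omega, mul_comm, H.map_top]
      exact one_pos
    · intro c' c hcc
      have h1 : c < c' := hcc
      have hc' := c'.isLt
      rw [Matrix.of_apply, mul_comm (x ^ _), ← mul_assoc, mul_right_comm (y ^ _), ← pow_add,
        H.pow_eq_zero_of_le (by omega), zero_mul, zero_mul, map_zero]

end IsTwoGen

end Almkvist

end

/-! ### Grading, monomial basis and Poincaré duality. -/

noncomputable section

namespace Almkvist

open Matrix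

variable {B : Type*} [CommRing B] [Algebra ℚ B] {m : ℕ} {x y : B} {φ : B →ₗ[ℚ] ℚ}

/-- The span of the monomials in `x` and `y` of degree `k`, where `deg x = 1`, `deg y = 2`. -/
def degSpan (x y : B) (k : ℕ) : Submodule ℚ B :=
  Submodule.span ℚ {z | ∃ a b, a + 2 * b = k ∧ x ^ a * y ^ b = z}

theorem pow_mul_pow_mem_degSpan (x y : B) {a b k : ℕ} (h : a + 2 * b = k) :
    x ^ a * y ^ b ∈ degSpan x y k :=
  Submodule.subset_span ⟨a, b, h, rfl⟩

theorem pow_mem_degSpan (x y : B) (n : ℕ) : x ^ n ∈ degSpan x y n := by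
  simpa using pow_mul_pow_mem_degSpan x y (a := n) (b := 0) rfl

theorem gradedMonoid_degSpan (x y : B) : SetLike.GradedMonoid (degSpan x y) where
  one_mem := by simpa using pow_mem_degSpan x y 0
  mul_mem := by
    intro i j α β hα hβ
    have h := Submodule.mul_mem_mul hα hβ
    rw [degSpan, degSpan, Submodule.span_mul_span] at h
    refine Submodule.span_mono ?_ h
    rintro _ ⟨_, ⟨a, b, h1, rfl⟩, _, ⟨a', b', h2, rfl⟩, rfl⟩
    exact ⟨a + a', b + b', by omega, by simp only; ring⟩

theorem mul_mem_degSpan {i j : ℕ} {α β : B} (hα : α ∈ degSpan x y i) (hβ : β ∈ degSpan x y j) :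
    α * β ∈ degSpan x y (i + j) :=
  (gradedMonoid_degSpan x y).mul_mem hα hβ

theorem hsym_mem_degSpan (x y : B) (n : ℕ) : hsym x y n ∈ degSpan x y n := by
  induction n using Nat.twoStepInduction with
  | zero => simpa [hsym] using pow_mem_degSpan x y 0
  | one => simpa [hsym] using pow_mem_degSpan x y 1
  | more n ih1 ih2 =>
    refine sub_mem ?_ ?_
    · simpa [add_comm, add_left_comm] using mul_mem_degSpan (pow_mem_degSpan x y 1) ih2
    · have := mul_mem_degSpan (pow_mul_pow_mem_degSpan x y (a := 0) (b := 1) rfl) ih1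
      simpa [add_comm] using this

/-- Turns the relation h_m = y h_(m-2) into a rewriting rule: x^m is y times an element of degree
m-2. Applying it lowers the exponent of x. -/
theorem exists_hsym_eq_pow_add (x y : B) (n : ℕ) :
    ∃ q ∈ degSpan x y n, hsym x y (n + 2) = x ^ (n + 2) + y * q := by
  induction n with
  | zero =>
    exact ⟨-1, neg_mem (by simpa using pow_mem_degSpan x y 0), by simp only [hsym]; ring⟩
  | succ n ih =>
    obtain ⟨q, hq, h⟩ := ih
    refine ⟨x * q - hsym x y (n + 1), sub_mem ?_ (hsym_mem_degSpan x y _), ?_⟩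
    · simpa [add_comm] using mul_mem_degSpan (pow_mem_degSpan x y 1) hq
    · rw [hsym, h]
      ring

/-- The exponents `b` such that `x ^ (k-2b) * y ^ b` belongs to the monomial basis. -/
def admissible (m k : ℕ) : Finset ℕ :=
  (Finset.range m).filter fun b => 2 * b ≤ k ∧ k < 2 * b + m

theorem mem_admissible {m k b : ℕ} :
    b ∈ admissible m k ↔ b < m ∧ 2 * b ≤ k ∧ k < 2 * b + m := by
  simp [admissible]

namespace IsTwoGen

theorem pow_mul_pow_mem_span (H : IsTwoGen m x y φ) (a b : ℕ) :
    x ^ a * y ^ b ∈ Submodule.span ℚ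
      ((fun b' => x ^ (a + 2 * b - 2 * b') * y ^ b') '' (admissible m (a + 2 * b) : Set ℕ)) := by
  induction a using Nat.strong_induction_on generalizing b with
  | _ a ih =>
    by_cases hb : m ≤ b
    · rw [H.pow_eq_zero_of_le hb, mul_zero]
      exact zero_mem _
    by_cases ha : a < m
    · refine Submodule.subset_span ⟨b, ?_, by simp⟩
      rw [Finset.mem_coe, mem_admissible]
      omega
    obtain ⟨c, rfl⟩ := Nat.exists_eq_add_of_le (not_lt.1 ha)
    rcases H.pos.eq_or_lt with rfl | hm
    · rw [H.eq_zero_of_one rfl, pow_add, pow_one, zero_mul, zero_mul]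
      exact zero_mem _
    obtain ⟨m, rfl⟩ : ∃ n, m = n + 2 := ⟨m - 2, by omega⟩
    obtain ⟨q, hq, h⟩ := exists_hsym_eq_pow_add x y m
    rw [H.hsym_eq (by omega), Nat.add_sub_cancel] at h
    have hx : x ^ (m + 2 + c) * y ^ b = (hsym x y m - q) * (x ^ c * y ^ (b + 1)) := by
      linear_combination (-x ^ c * y ^ b) * h
    rw [hx]
    have hmem : hsym x y m - q ∈ degSpan x y m := sub_mem (hsym_mem_degSpan x y m) hq
    rw [← LinearMap.mulRight_apply (R := ℚ) (x ^ c * y ^ (b + 1)), ← Submodule.mem_comap]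
    revert hmem
    generalize hsym x y m - q = q'
    intro hmem
    refine Submodule.span_le.2 ?_ hmem
    rintro _ ⟨a', b', hab, rfl⟩
    have h1 := ih (a' + c) (by omega) (b' + (b + 1))
    rw [show a' + c + 2 * (b' + (b + 1)) = m + 2 + c + 2 * b by omega] at h1
    rw [SetLike.mem_coe, Submodule.mem_comap, LinearMap.mulRight_apply]
    convert h1 using 1
    ring

theorem degSpan_eq_span (H : IsTwoGen m x y φ) (k : ℕ) :
    degSpan x y k = Submodule.span ℚ
      (Set.range fun b : admissible m k => x ^ (k - 2 * (b : ℕ)) * y ^ (b : ℕ)) := by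
  apply le_antisymm
  · refine Submodule.span_le.2 ?_
    rintro _ ⟨a, b, rfl, rfl⟩
    have h := H.pow_mul_pow_mem_span a b
    rwa [Set.image_eq_range] at h
  · refine Submodule.span_le.2 ?_
    rintro _ ⟨b, rfl⟩
    have := mem_admissible.1 b.2
    exact pow_mul_pow_mem_degSpan x y (by omega)

theorem map_degSpan_eq_zero (H : IsTwoGen m x y φ) {k : ℕ} (hk : k ≠ 3 * (m - 1)) {α : B}
    (hα : α ∈ degSpan x y k) : φ α = 0 := by
  rw [← LinearMap.mem_ker]
  refine Submodule.span_le.2 ?_ hα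
  rintro _ ⟨a, b, rfl, rfl⟩
  exact H.map_eq_zero a b hk

theorem degSpan_eq_bot (H : IsTwoGen m x y φ) {k : ℕ} (hk : 3 * (m - 1) < k) :
    degSpan x y k = ⊥ := by
  rw [H.degSpan_eq_span, Submodule.span_eq_bot]
  rintro _ ⟨b, rfl⟩
  have := mem_admissible.1 b.2
  omega

/-- Test against the monomial complementary to b, so that the product is x^(m-1) y^(m-1). Terms with
larger b' vanish by y^m = 0, those with smaller b' by induction. Duality and linear independence of
the monomials both follow. -/
theorem coeff_eq_zero (H : IsTwoGen m x y φ) (k : ℕ) (c : admissible m k → ℚ)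
    (h : ∀ β ∈ degSpan x y (3 * (m - 1) - k),
      φ ((∑ b, c b • (x ^ (k - 2 * (b : ℕ)) * y ^ (b : ℕ))) * β) = 0) (b : admissible m k) :
    c b = 0 := by
  obtain ⟨b, hb⟩ := b
  induction b using Nat.strong_induction_on with
  | _ b ih =>
    have hb' := mem_admissible.1 hb
    have h1 := h (x ^ (m - 1 - (k - 2 * b)) * y ^ (m - 1 - b))
      (pow_mul_pow_mem_degSpan x y (by omega))
    rw [Finset.sum_mul, map_sum, Finset.sum_eq_single_of_mem ⟨b, hb⟩ (Finset.mem_univ _)] at h1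
    · rw [smul_mul_assoc, map_smul, smul_eq_mul] at h1
      have h2 : x ^ (k - 2 * b) * y ^ b * (x ^ (m - 1 - (k - 2 * b)) * y ^ (m - 1 - b)) =
          x ^ (m - 1) * y ^ (m - 1) := by
        rw [mul_mul_mul_comm, ← pow_add, ← pow_add]
        congr 2 <;> omega
      rw [h2, H.map_top, mul_one] at h1
      exact h1
    · rintro ⟨b', hb2⟩ _ hne
      have hne' : b' ≠ b := fun h => hne (Subtype.ext h)
      rcases lt_or_gt_of_ne hne' with hlt | hgt
      · rw [ih b' hlt hb2, zero_smul, zero_mul, map_zero]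
      · have h2 : y ^ b' * y ^ (m - 1 - b) = 0 := by
          rw [← pow_add]
          exact H.pow_eq_zero_of_le (by omega)
        rw [smul_mul_assoc, mul_mul_mul_comm, h2, mul_zero, smul_zero, map_zero]

theorem eq_zero_of_pairing (H : IsTwoGen m x y φ) {k : ℕ} {α : B} (hα : α ∈ degSpan x y k)
    (h : ∀ β ∈ degSpan x y (3 * (m - 1) - k), φ (α * β) = 0) : α = 0 := by
  rw [H.degSpan_eq_span, Submodule.mem_span_range_iff_exists_fun] at hα
  obtain ⟨c, rfl⟩ := hα
  exact Finset.sum_eq_zero fun b _ => by rw [H.coeff_eq_zero k c h b, zero_smul]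

theorem finrank_degSpan (H : IsTwoGen m x y φ) (k : ℕ) :
    Module.finrank ℚ (degSpan x y k) = (admissible m k).card := by
  rw [H.degSpan_eq_span, finrank_span_eq_card, Fintype.card_coe]
  rw [Fintype.linearIndependent_iff]
  intro c hc b
  exact H.coeff_eq_zero k c (fun β _ => by rw [hc, zero_mul, map_zero]) b

/-- An element of degree i that is also a sum of elements of other degrees pairs to zero with degree
d-i, as φ lives in degree d only; duality then kills it. -/
theorem iSupIndep_degSpan (H : IsTwoGen m x y φ) : iSupIndep (degSpan x y) := by
  intro i
  rw [Submodule.disjoint_def]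
  intro α hα hα'
  by_cases hi : 3 * (m - 1) < i
  · rwa [H.degSpan_eq_bot hi, Submodule.mem_bot] at hα
  refine H.eq_zero_of_pairing hα fun β hβ => ?_
  have h1 : (⨆ (j) (_ : j ≠ i), degSpan x y j) ≤
      LinearMap.ker (φ ∘ₗ LinearMap.mulRight ℚ β) := by
    refine iSup₂_le fun j hj γ hγ => ?_
    rw [LinearMap.mem_ker, LinearMap.comp_apply, LinearMap.mulRight_apply]
    exact H.map_degSpan_eq_zero (by omega) (mul_mem_degSpan hγ hβ)
  exact h1 hα'

theorem iSup_degSpan (H : IsTwoGen m x y φ) : iSup (degSpan x y) = ⊤ := by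
  rw [eq_top_iff, ← H.span_eq_top, Submodule.span_le]
  rintro _ ⟨⟨a, b⟩, rfl⟩
  exact Submodule.mem_iSup_of_mem (a + 2 * b) (pow_mul_pow_mem_degSpan x y rfl)

theorem finite (H : IsTwoGen m x y φ) : Module.Finite ℚ B := by
  refine ⟨?_⟩
  have h : (⊤ : Submodule ℚ B) =
      Submodule.span ℚ ((fun p : ℕ × ℕ => x ^ p.1 * y ^ p.2) ''
        (Finset.range m ×ˢ Finset.range m : Finset (ℕ × ℕ))) := by
    refine (eq_top_iff.2 ?_).symm
    rw [← H.iSup_degSpan]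
    refine iSup_le fun k => ?_
    rw [H.degSpan_eq_span, Submodule.span_le]
    rintro _ ⟨b, rfl⟩
    have := mem_admissible.1 b.2
    refine Submodule.subset_span ⟨(k - 2 * b, b), ?_, rfl⟩
    simp only [Finset.coe_product, Set.mem_prod, Finset.mem_coe, Finset.mem_range]
    omega
  rw [h]
  exact Submodule.fg_span ((Finset.finite_toSet _).image _)

theorem bijOn_top (H : IsTwoGen m x y φ) :
    Set.BijOn φ (degSpan x y (3 * (m - 1)) : Set B) Set.univ := by
  have hpos := H.pos
  have hmem : x ^ (m - 1) * y ^ (m - 1) ∈ degSpan x y (3 * (m - 1)) :=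
    pow_mul_pow_mem_degSpan x y (by omega)
  have hall : ∀ α ∈ degSpan x y (3 * (m - 1)), α = φ α • (x ^ (m - 1) * y ^ (m - 1)) := by
    intro α hα
    rw [H.degSpan_eq_span] at hα
    have hsub : Submodule.span ℚ (Set.range fun b : admissible m (3 * (m - 1)) =>
        x ^ (3 * (m - 1) - 2 * (b : ℕ)) * y ^ (b : ℕ)) ≤
        Submodule.span ℚ {x ^ (m - 1) * y ^ (m - 1)} := by
      refine Submodule.span_mono ?_
      rintro _ ⟨⟨b, hb⟩, rfl⟩
      have := mem_admissible.1 hb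
      obtain rfl : b = m - 1 := by omega
      simp only [Set.mem_singleton_iff]
      congr 2
      omega
    obtain ⟨c, rfl⟩ := Submodule.mem_span_singleton.1 (hsub hα)
    rw [map_smul, H.map_top, smul_eq_mul, mul_one]
  refine ⟨fun _ _ => Set.mem_univ _, fun α hα β hβ h => ?_, fun c _ => ?_⟩
  · rw [hall α hα, hall β hβ, h]
  · exact ⟨c • (x ^ (m - 1) * y ^ (m - 1)), Submodule.smul_mem _ _ hmem, by
      rw [map_smul, H.map_top, smul_eq_mul, mul_one]⟩

theorem isOrientedAG (H : IsTwoGen m x y φ) : IsOrientedAG (degSpan x y) (3 * (m - 1)) φ where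
  finite := H.finite
  gradedMonoid := gradedMonoid_degSpan x y
  isInternal := DirectSum.isInternal_submodule_of_iSupIndep_of_iSup_eq_top
    H.iSupIndep_degSpan H.iSup_degSpan
  eq_bot _ hk := H.degSpan_eq_bot hk
  orientation := H.bijOn_top
  orientation_of_ne _ hk _ hα := H.map_degSpan_eq_zero hk hα
  nondegenerate_left _ _ _ hα h := H.eq_zero_of_pairing hα h
  nondegenerate_right i hi β hβ h := by
    refine H.eq_zero_of_pairing hβ fun α hα => ?_
    rw [show 3 * (m - 1) - (3 * (m - 1) - i) = i by omega] at hα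
    rw [mul_comm]
    exact h α hα

end IsTwoGen

end Almkvist

end

/-! ### Lefschetz and Hodge–Riemann properties in degrees up to m-2. -/

noncomputable section

namespace Almkvist

open Matrix

namespace IsTwoGen

variable {B : Type*} [CommRing B] [Algebra ℚ B] {m : ℕ} {x y : B} {φ : B →ₗ[ℚ] ℚ}

theorem exists_eq_sum_of_mem_degSpan_even {s : ℕ} {α : B} (hα : α ∈ degSpan x y (2 * s)) :
    ∃ a : Fin (s + 1) → ℚ, ∑ r, a r • (x ^ (2 * (s - r) : ℕ) * y ^ (r : ℕ)) = α := by
  rw [← Submodule.mem_span_range_iff_exists_fun]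
  refine Submodule.span_mono ?_ hα
  rintro _ ⟨a, b, h, rfl⟩
  exact ⟨⟨b, by omega⟩, by simp only; congr 2; omega⟩

theorem map_mul_eq_vecMul_toeplitz {s : ℕ} (hs : 2 * s ≤ m - 2) (a : Fin (s + 1) → ℚ)
    (c : Fin (s + 1)) :
    φ (x ^ (3 * (m - 1) - 2 * (2 * s)) * (∑ r, a r • (x ^ (2 * (s - r) : ℕ) * y ^ (r : ℕ))) *
      (x ^ (2 * c : ℕ) * y ^ (s - c : ℕ))) = (a ᵥ* toeplitz m x y φ s) c := by
  rw [Finset.mul_sum, Finset.sum_mul, map_sum, Matrix.vecMul, dotProduct]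
  refine Finset.sum_congr rfl fun r _ => ?_
  rw [mul_smul_comm, smul_mul_assoc, map_smul, smul_eq_mul, toeplitz, Matrix.of_apply, moment,
    show 3 * (m - 1) - 2 * (r + (s - c)) =
      3 * (m - 1) - 2 * (2 * s) + 2 * (s - r) + 2 * c by omega]
  congr 2
  ring

theorem eq_zero_of_pow_mul_even (H : IsTwoGen m x y φ) {s : ℕ} (hs : 2 * s ≤ m - 2) {α : B}
    (hα : α ∈ degSpan x y (2 * s)) (h : x ^ (3 * (m - 1) - 2 * (2 * s)) * α = 0) : α = 0 := by
  obtain ⟨a, rfl⟩ := exists_eq_sum_of_mem_degSpan_even hα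
  have ha : a = 0 := by
    refine Matrix.eq_zero_of_vecMul_eq_zero (H.det_toeplitz_pos hs).ne' ?_
    ext c
    rw [← map_mul_eq_vecMul_toeplitz hs, h, zero_mul, map_zero, Pi.zero_apply]
  simp [ha]

/-- Deleting the last row and first column of T_s leaves T_(s-1); for s = 0 the determinant is
empty. -/
theorem det_submatrix_toeplitz_pos (H : IsTwoGen m x y φ) {s : ℕ} (hs : 2 * s ≤ m - 2) :
    0 < ((toeplitz m x y φ s).submatrix (Fin.last s).succAbove (Fin.succAbove 0)).det := by
  cases s with
  | zero => simp
  | succ s =>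
    have h := H.det_toeplitz_pos (s := s) (by omega)
    convert h using 2
    ext r c
    have hc := c.isLt
    simp only [toeplitz, Matrix.submatrix_apply, Matrix.of_apply, Fin.succAbove_last,
      Fin.succAbove_zero, Fin.val_castSucc, Fin.val_succ]
    congr 1
    omega

/-- Primitivity kills the pairing with every monomial divisible by x, so the coefficient vector a
satisfies a T_s = (v, 0, …, 0), and the form takes the value a_s v. By Cramer, a_s = (-1)^s v det
T_(s-1) / det T_s. -/
theorem hodgeRiemann_even (H : IsTwoGen m x y φ) {s : ℕ} (hs : 2 * s ≤ m - 2) {α : B}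
    (hα : α ∈ degSpan x y (2 * s)) (h : x ^ (3 * (m - 1) - 2 * (2 * s) + 1) * α = 0)
    (hne : α ≠ 0) : 0 < (-1 : ℚ) ^ s * φ (x ^ (3 * (m - 1) - 2 * (2 * s)) * α ^ 2) := by
  obtain ⟨a, ha⟩ := exists_eq_sum_of_mem_degSpan_even hα
  set T := toeplitz m x y φ s
  set v := φ (x ^ (3 * (m - 1) - 2 * (2 * s)) * α * y ^ s) with hv
  have hpow : ∀ n, n ≠ 0 → x ^ (3 * (m - 1) - 2 * (2 * s)) * α * x ^ n = 0 := by
    intro n hn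
    obtain ⟨n, rfl⟩ := Nat.exists_eq_succ_of_ne_zero hn
    have : x ^ (3 * (m - 1) - 2 * (2 * s)) * α * x ^ (n + 1) =
        x ^ (3 * (m - 1) - 2 * (2 * s) + 1) * α * x ^ n := by ring
    rw [this, h, zero_mul]
  have haT : a ᵥ* T = Pi.single 0 v := by
    ext c
    rw [← map_mul_eq_vecMul_toeplitz hs, ha]
    by_cases hc : c = 0
    · subst hc
      simp [hv]
    · have hc' : (c : ℕ) ≠ 0 := fun h => hc (Fin.ext h)
      rw [Pi.single_eq_of_ne hc, ← mul_assoc, hpow _ (by omega), zero_mul, map_zero]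
  have hdet : 0 < T.det := H.det_toeplitz_pos hs
  have hv0 : v ≠ 0 := by
    intro h0
    rw [h0, Pi.single_zero] at haT
    have := Matrix.eq_zero_of_vecMul_eq_zero hdet.ne' haT
    exact hne (by rw [← ha, this]; simp)
  have hcramer : T.det * a (Fin.last s) = v * ((-1) ^ s *
      (T.submatrix (Fin.last s).succAbove (Fin.succAbove 0)).det) := by
    have h1 : (a ᵥ* T) ᵥ* T.adjugate = T.det • a := by
      rw [Matrix.vecMul_vecMul, Matrix.mul_adjugate, Matrix.vecMul_smul, Matrix.vecMul_one]
    have h2 := congrFun h1 (Fin.last s)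
    rw [haT, Matrix.single_vecMul, Pi.smul_apply, Pi.smul_apply, smul_eq_mul, smul_eq_mul] at h2
    rw [← h2, Matrix.row_apply, Matrix.adjugate_fin_succ_eq_det_submatrix]
    simp
  have hval : φ (x ^ (3 * (m - 1) - 2 * (2 * s)) * α ^ 2) = a (Fin.last s) * v := by
    rw [pow_two, ← mul_assoc]
    nth_rewrite 2 [← ha]
    rw [Finset.mul_sum, map_sum, Finset.sum_eq_single_of_mem (Fin.last s) (Finset.mem_univ _)]
    · simp [hv]
    · intro r _ hr
      have := Fin.val_lt_last hr
      rw [mul_smul_comm, ← mul_assoc, hpow _ (by omega), zero_mul, smul_zero, map_zero]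
  have hminor := H.det_submatrix_toeplitz_pos hs
  rw [hval]
  refine pos_of_mul_pos_right (a := T.det) ?_ hdet.le
  have hsq : ((-1 : ℚ) ^ s) * (-1) ^ s = 1 := by rw [← mul_pow]; simp
  have : T.det * ((-1) ^ s * (a (Fin.last s) * v)) = v ^ 2 *
      (T.submatrix (Fin.last s).succAbove (Fin.succAbove 0)).det := by
    linear_combination ((-1) ^ s * v) * hcramer +
      (v ^ 2 * (T.submatrix (Fin.last s).succAbove (Fin.succAbove 0)).det) * hsq
  rw [this]
  exact mul_pos (by positivity) hminor

theorem exists_eq_mul_of_mem_degSpan_odd {s : ℕ} {α : B} (hα : α ∈ degSpan x y (2 * s + 1)) :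
    ∃ β ∈ degSpan x y (2 * s), α = x * β := by
  have h : degSpan x y (2 * s + 1) ≤ (degSpan x y (2 * s)).map (LinearMap.mulLeft ℚ x) := by
    refine Submodule.span_le.2 ?_
    rintro _ ⟨a, b, hab, rfl⟩
    obtain ⟨a, rfl⟩ : ∃ a', a = a' + 1 := ⟨a - 1, by omega⟩
    refine ⟨x ^ a * y ^ b, pow_mul_pow_mem_degSpan x y (by omega), ?_⟩
    rw [LinearMap.mulLeft_apply]
    ring
  obtain ⟨β, hβ, rfl⟩ := h hα
  exact ⟨β, hβ, rfl⟩

/-- Every monomial of odd degree is divisible by x, and the extra factor x turns the exponent into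
the one for degree 2s. -/
theorem eq_zero_of_pow_mul_odd (H : IsTwoGen m x y φ) {s : ℕ} (hs : 2 * s + 1 ≤ m - 2) {α : B}
    (hα : α ∈ degSpan x y (2 * s + 1))
    (h : x ^ (3 * (m - 1) - 2 * (2 * s + 1) + 1) * α = 0) : α = 0 := by
  obtain ⟨β, hβ, rfl⟩ := exists_eq_mul_of_mem_degSpan_odd hα
  rw [H.eq_zero_of_pow_mul_even (by omega) hβ, mul_zero]
  rw [← mul_assoc, ← pow_succ] at h
  rw [← h]
  congr 2
  omega

theorem eq_zero_of_pow_mul_of_le {B : Type*} [CommRing B] {x : B} {n n' : ℕ} {α : B} (hn : n ≤ n') (h : x ^ n * α = 0) :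
    x ^ n' * α = 0 := by
  rw [← Nat.sub_add_cancel hn, pow_add, mul_assoc, h, mul_zero]

theorem eq_zero_of_pow_mul_low (H : IsTwoGen m x y φ) {i : ℕ} (hi : i ≤ m - 2) {α : B}
    (hα : α ∈ degSpan x y i) (h : x ^ (3 * (m - 1) - 2 * i) * α = 0) : α = 0 := by
  rcases Nat.even_or_odd' i with ⟨s, rfl | rfl⟩
  · exact H.eq_zero_of_pow_mul_even hi hα h
  · exact H.eq_zero_of_pow_mul_odd hi hα (eq_zero_of_pow_mul_of_le (Nat.le_succ _) h)

theorem map_pow_le_degSpan (x y : B) {n i k : ℕ} (h : n + i = k) :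
    (degSpan x y i).map (LinearMap.mulLeft ℚ (x ^ n)) ≤ degSpan x y k := by
  rintro _ ⟨α, hα, rfl⟩
  exact h ▸ mul_mem_degSpan (pow_mem_degSpan x y n) hα

theorem finrank_map_pow {n i : ℕ} (h : ∀ α ∈ degSpan x y i, x ^ n * α = 0 → α = 0) :
    Module.finrank ℚ ((degSpan x y i).map (LinearMap.mulLeft ℚ (x ^ n))) =
      Module.finrank ℚ (degSpan x y i) := by
  rw [← LinearMap.range_domRestrict]
  refine LinearMap.finrank_range_of_inj ?_
  rw [← LinearMap.ker_eq_bot, LinearMap.ker_eq_bot']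
  rintro ⟨α, hα⟩ h0
  exact Subtype.ext (h α hα h0)

theorem map_pow_eq_degSpan (H : IsTwoGen m x y φ) {n i k : ℕ} (hk : n + i = k)
    (hcard : (admissible m k).card ≤ (admissible m i).card)
    (h : ∀ α ∈ degSpan x y i, x ^ n * α = 0 → α = 0) :
    (degSpan x y i).map (LinearMap.mulLeft ℚ (x ^ n)) = degSpan x y k := by
  have := H.finite
  refine Submodule.eq_of_le_of_finrank_le (map_pow_le_degSpan x y hk) ?_
  rwa [finrank_map_pow h, H.finrank_degSpan, H.finrank_degSpan]

/-! ### Degrees above m-2, and ranks. -/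

theorem card_admissible_le {j : ℕ} (hm : 2 ≤ m) (h : Even m ∨ Odd j) :
    (admissible m j).card ≤ (admissible m (m - 2)).card := by
  -- Admissibility gives j-2b ≤ m-1, and the parity assumption improves this to 2(j/2 - b) ≤ m-2.
  refine Finset.card_le_card_of_injOn (fun b => j / 2 - b) ?_ ?_
  · intro b hb
    have hb' := mem_admissible.1 hb
    change j / 2 - b ∈ admissible m (m - 2)
    rw [mem_admissible]
    rcases h with ⟨k, hk⟩ | ⟨k, hk⟩ <;> omega
  · intro b hb b' hb' hbb
    have h1 := mem_admissible.1 hb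
    have h2 := mem_admissible.1 hb'
    simp only at hbb
    omega

theorem card_admissible_symm {i : ℕ} (hi : i ≤ 3 * (m - 1)) :
    (admissible m (3 * (m - 1) - i)).card ≤ (admissible m i).card := by
  refine Finset.card_le_card_of_injOn (fun b => m - 1 - b) ?_ ?_
  · intro b hb
    have hb' := mem_admissible.1 hb
    change m - 1 - b ∈ admissible m i
    rw [mem_admissible]
    omega
  · intro b hb b' hb' hbb
    have h1 := mem_admissible.1 hb
    have h2 := mem_admissible.1 hb'
    simp only at hbb
    omega

/-- The bound 2m-1 is d-(m-2): up to there, powers of x are injective on degree m-2, and a dimension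
count makes the map onto. -/
theorem map_pow_eq_degSpan_high (H : IsTwoGen m x y φ) (hm : 2 ≤ m) {i : ℕ} (hi : m - 2 ≤ i)
    (hi2 : i ≤ 2 * m - 1) (h : Even m ∨ Odd i) :
    (degSpan x y (m - 2)).map (LinearMap.mulLeft ℚ (x ^ (i - (m - 2)))) = degSpan x y i :=
  H.map_pow_eq_degSpan (by omega) (card_admissible_le hm h) fun _ hα h0 =>
    H.eq_zero_of_pow_mul_low le_rfl hα (eq_zero_of_pow_mul_of_le (by omega) h0)

/-- Write α = x^(i-(m-2)) β with β of degree m-2. As i ≥ m-1, the total power of x applied to β is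
at most d-2(m-2), hence injective. -/
theorem eq_zero_of_pow_mul_high (H : IsTwoGen m x y φ) (hm : 2 ≤ m) {i : ℕ} (hi : m - 1 ≤ i)
    (hi2 : i ≤ 3 * (m - 1) / 2) (h : Even m ∨ Odd i) {α : B} (hα : α ∈ degSpan x y i)
    (h0 : x ^ (3 * (m - 1) - 2 * i + 1) * α = 0) : α = 0 := by
  rw [← H.map_pow_eq_degSpan_high hm (by omega) (by omega) h] at hα
  obtain ⟨β, hβ, rfl⟩ := hα
  rw [LinearMap.mulLeft_apply, ← mul_assoc, ← pow_add] at h0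
  rw [H.eq_zero_of_pow_mul_low le_rfl hβ (eq_zero_of_pow_mul_of_le (by omega) h0), map_zero]

theorem eq_zero_of_pow_mul (H : IsTwoGen m x y φ) {i : ℕ} (hi : i ≤ 3 * (m - 1) / 2)
    (h : i ≤ m - 2 ∨ Even m ∨ Odd i) {α : B} (hα : α ∈ degSpan x y i)
    (h0 : x ^ (3 * (m - 1) - 2 * i) * α = 0) : α = 0 := by
  by_cases hlow : i ≤ m - 2
  · exact H.eq_zero_of_pow_mul_low hlow hα h0
  · exact H.eq_zero_of_pow_mul_high (by omega) (by omega) hi (h.resolve_left hlow) hα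
      (eq_zero_of_pow_mul_of_le (Nat.le_succ _) h0)

theorem isSL (H : IsTwoGen m x y φ) {r : ℕ} (hr : r ≤ 3 * (m - 1) / 2)
    (h : r ≤ m - 2 ∨ Even m) : IsSL (degSpan x y) (3 * (m - 1)) x r := by
  intro i hi
  have hinj : ∀ α ∈ degSpan x y i, x ^ (3 * (m - 1) - 2 * i) * α = 0 → α = 0 := fun α hα h0 =>
    H.eq_zero_of_pow_mul (hi.trans hr) (h.imp hi.trans Or.inl) hα h0
  have hmap := H.map_pow_eq_degSpan (k := 3 * (m - 1) - i) (by omega)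
    (card_admissible_symm (by omega)) hinj
  refine ⟨fun α hα => ?_, fun α hα β hβ hab => ?_, fun γ hγ => ?_⟩
  · rw [← hmap]
    exact ⟨α, hα, rfl⟩
  · refine sub_eq_zero.1 (hinj _ (sub_mem hα hβ) ?_)
    rw [mul_sub]
    exact sub_eq_zero.2 hab
  · rw [← hmap] at hγ
    exact hγ

theorem isComplexHRR (H : IsTwoGen m x y φ) {r : ℕ} (hr : r ≤ 3 * (m - 1) / 2)
    (h : r ≤ m - 2 ∨ Even m) : IsComplexHRR (degSpan x y) (3 * (m - 1)) φ x r := by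
  intro i hi
  have hmem : ∀ α ∈ primitive (degSpan x y) (3 * (m - 1)) x i,
      α ∈ degSpan x y i ∧ x ^ (3 * (m - 1) - 2 * i + 1) * α = 0 := fun α hα => hα
  by_cases hlow : i ≤ m - 2
  · constructor
    · rintro ⟨s, rfl⟩
      rw [Submodule.eq_bot_iff]
      exact fun α hα => H.eq_zero_of_pow_mul_odd hlow (hmem α hα).1 (hmem α hα).2
    · rw [even_iff_exists_two_mul]
      rintro ⟨s, rfl⟩ α hα hne
      rw [Nat.mul_div_cancel_left s two_pos]
      exact H.hodgeRiemann_even hlow (hmem α hα).1 (hmem α hα).2 hne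
  · have hm : Even m := h.resolve_left fun h => hlow (hi.trans h)
    have hzero : ∀ α ∈ primitive (degSpan x y) (3 * (m - 1)) x i, α = 0 := fun α hα =>
      H.eq_zero_of_pow_mul_high (by obtain ⟨k, rfl⟩ := hm; omega) (by omega) (hi.trans hr)
        (Or.inl hm) (hmem α hα).1 (hmem α hα).2
    exact ⟨fun _ => (Submodule.eq_bot_iff _).2 hzero, fun _ α hα hne => absurd (hzero α hα) hne⟩

theorem finrank_map_le_degSpan (H : IsTwoGen m x y φ) {i j n : ℕ} (hij : i ≤ j) (hjn : j ≤ n + i) :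
    Module.finrank ℚ ((degSpan x y i).map (LinearMap.mulLeft ℚ (x ^ n))) ≤
      Module.finrank ℚ (degSpan x y j) := by
  have := H.finite
  have h1 : (degSpan x y i).map (LinearMap.mulLeft ℚ (x ^ n)) ≤
      (degSpan x y j).map (LinearMap.mulLeft ℚ (x ^ (n - (j - i)))) := by
    rintro _ ⟨α, hα, rfl⟩
    refine ⟨x ^ (j - i) * α, map_pow_le_degSpan x y (by omega) ⟨α, hα, rfl⟩, ?_⟩
    rw [LinearMap.mulLeft_apply, LinearMap.mulLeft_apply, ← mul_assoc, ← pow_add,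
      Nat.sub_add_cancel (by omega)]
  exact (Submodule.finrank_mono h1).trans (Submodule.finrank_map_le _ _)

theorem isHLP (H : IsTwoGen m x y φ) : IsHLP (degSpan x y) (3 * (m - 1)) x := by
  intro i hi
  have := H.finite
  refine ⟨?_, ?_⟩
  · by_cases h : i ≤ m - 2 ∨ Even m ∨ Odd i
    · refine ⟨i, ⟨le_rfl, by omega⟩, ?_⟩
      exact (finrank_map_pow fun α hα h0 => H.eq_zero_of_pow_mul hi h hα h0).symm
    by_cases h0 : 3 * (m - 1) - 2 * i = 0
    · refine ⟨i, ⟨le_rfl, by omega⟩, ?_⟩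
      exact (finrank_map_pow fun α _ h1 => by rwa [h0, pow_zero, one_mul] at h1).symm
    · simp only [not_or, Nat.not_even_iff_odd, Nat.not_odd_iff_even] at h
      obtain ⟨hlow, hm, hev⟩ := h
      have hd : 3 * (m - 1) - 2 * i ≠ 1 := by
        obtain ⟨k, rfl⟩ := hm
        omega
      -- Here m is odd and i is even, so i+1 is odd and h_(i+1) ≤ h_(m-2). Degree m-2 embeds by a
      -- power of x that factors through degree i, so the rank is at least h_(m-2).
      refine ⟨i + 1, ⟨by omega, by omega⟩, le_antisymm ?_
        (H.finrank_map_le_degSpan (by omega) (by omega))⟩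
      simp only
      rw [H.finrank_degSpan]
      refine (card_admissible_le (by omega) (Or.inr hev.add_one)).trans ?_
      rw [← H.finrank_degSpan, ← finrank_map_pow (n := 3 * (m - 1) - i - (m - 2))
        fun α hα h1 => H.eq_zero_of_pow_mul_low le_rfl hα (eq_zero_of_pow_mul_of_le (by omega) h1)]
      refine Submodule.finrank_mono ?_
      rintro _ ⟨α, hα, rfl⟩
      refine ⟨x ^ (i - (m - 2)) * α, map_pow_le_degSpan x y (by omega) ⟨α, hα, rfl⟩, ?_⟩
      rw [LinearMap.mulLeft_apply, LinearMap.mulLeft_apply, ← mul_assoc, ← pow_add]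
      congr 2
      omega
  · rintro _ ⟨j, ⟨h1, h2⟩, rfl⟩
    exact H.finrank_map_le_degSpan h1 (by omega)

end IsTwoGen

end Almkvist

end

/-! ### Generators, relations and grading of A(m,2). -/

noncomputable section

namespace Almkvist

open MvPolynomial

theorem esymm_two_one : esymm (Fin 2) ℚ 1 = X 0 + X 1 := by
  rw [esymm_one, Fin.sum_univ_two]

theorem esymm_two_two : esymm (Fin 2) ℚ 2 = X 0 * X 1 := by
  have h : Finset.powersetCard 2 (Finset.univ : Finset (Fin 2)) = {Finset.univ} :=
    Finset.powersetCard_self _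
  rw [esymm, h, Finset.sum_singleton, Fin.prod_univ_two]

theorem powEsymm_two_one (m : ℕ) : powEsymm m 2 1 = X 0 ^ m + X 1 ^ m := by
  simp [powEsymm]

theorem powEsymm_two_two (m : ℕ) : powEsymm m 2 2 = X 0 ^ m * X 1 ^ m := by
  simp [powEsymm, esymm_two_two]

/-- The element `x₁ + x₂` of the algebra of symmetric polynomials. -/
def sumGen : esymmSubalgebra 2 := ⟨esymm (Fin 2) ℚ 1, Algebra.subset_adjoin ⟨0, rfl⟩⟩

/-- The element `x₁x₂` of the algebra of symmetric polynomials. -/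
def prodGen : esymmSubalgebra 2 := ⟨esymm (Fin 2) ℚ 2, Algebra.subset_adjoin ⟨1, rfl⟩⟩

theorem coe_sumGen : (sumGen : MvPolynomial (Fin 2) ℚ) = X 0 + X 1 := esymm_two_one

theorem coe_prodGen : (prodGen : MvPolynomial (Fin 2) ℚ) = X 0 * X 1 := esymm_two_two

theorem exists_eq_sum_gen (f : esymmSubalgebra 2) : ∃ q : MvPolynomial (Fin 2) ℚ,
    f = ∑ d ∈ q.support, q.coeff d • (sumGen ^ d 0 * prodGen ^ d 1) := by
  obtain ⟨f, hf⟩ := f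
  have hf' := hf
  rw [esymmSubalgebra, Algebra.adjoin_range_eq_range_aeval] at hf'
  obtain ⟨q, rfl⟩ := hf'
  refine ⟨q, Subtype.ext ?_⟩
  simp only [AddSubmonoidClass.coe_finsetSum, Subalgebra.coe_smul, Subalgebra.coe_mul,
    Subalgebra.coe_pow]
  change aeval _ q = _
  rw [aeval_def, eval₂_eq']
  refine Finset.sum_congr rfl fun d _ => ?_
  rw [Fin.prod_univ_two, Algebra.smul_def]
  rfl

theorem isHomogeneous_gen (a b : ℕ) :
    ((sumGen ^ a * prodGen ^ b : esymmSubalgebra 2) : MvPolynomial (Fin 2) ℚ).IsHomogeneous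
      (a + 2 * b) := by
  rw [Subalgebra.coe_mul, Subalgebra.coe_pow, Subalgebra.coe_pow, coe_sumGen, coe_prodGen]
  have h1 : (X 0 + X 1 : MvPolynomial (Fin 2) ℚ).IsHomogeneous 1 :=
    (isHomogeneous_X _ _).add (isHomogeneous_X _ _)
  have h2 : (X 0 * X 1 : MvPolynomial (Fin 2) ℚ).IsHomogeneous 2 :=
    (isHomogeneous_X _ _).mul (isHomogeneous_X _ _)
  simpa using (h1.pow a).mul (h2.pow b)

theorem grade_eq_degSpan (m k : ℕ) :
    grade m 2 k = degSpan (toA m 2 sumGen) (toA m 2 prodGen) k := by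
  apply le_antisymm
  · rintro _ ⟨f, hf, rfl⟩
    obtain ⟨q, hq⟩ := exists_eq_sum_gen f
    have hf' : (f : MvPolynomial (Fin 2) ℚ) ∈ homogeneousSubmodule (Fin 2) ℚ k := hf
    have hcomp := homogeneousComponent_of_mem (n := k) (m := k) hf'
    rw [if_pos rfl] at hcomp
    -- Taking the homogeneous component of degree k in x₁, x₂ keeps exactly the monomials e₁^a e₂^b
    -- with a+2b = k.
    have hsum : f = ∑ d ∈ q.support,
        if k = d 0 + 2 * d 1 then q.coeff d • (sumGen ^ d 0 * prodGen ^ d 1) else 0 := by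
      apply Subtype.ext
      rw [← hcomp]
      nth_rewrite 1 [hq]
      rw [AddSubmonoidClass.coe_finsetSum, map_sum, AddSubmonoidClass.coe_finsetSum]
      refine Finset.sum_congr rfl fun d _ => ?_
      rw [Subalgebra.coe_smul, map_smul, homogeneousComponent_of_mem (isHomogeneous_gen _ _)]
      split_ifs <;> simp
    rw [hsum, map_sum]
    refine sum_mem fun d _ => ?_
    split_ifs with hd
    · rw [map_smul]
      refine Submodule.smul_mem _ _ ?_
      rw [AlgHom.toLinearMap_apply, map_mul, map_pow, map_pow]
      exact pow_mul_pow_mem_degSpan _ _ hd.symm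
    · rw [map_zero]
      exact zero_mem _
  · refine Submodule.span_le.2 ?_
    rintro _ ⟨a, b, rfl, rfl⟩
    exact ⟨sumGen ^ a * prodGen ^ b, isHomogeneous_gen a b, by simp⟩

theorem toA_eq_zero {m : ℕ} {f : esymmSubalgebra 2} (hf : f ∈ powEsymmIdeal m 2) :
    toA m 2 f = 0 :=
  Ideal.Quotient.eq_zero_iff_mem.2 hf

theorem mem_of_toA_eq_zero {m : ℕ} {f : esymmSubalgebra 2} (hf : toA m 2 f = 0) :
    f ∈ powEsymmIdeal m 2 :=
  Ideal.Quotient.eq_zero_iff_mem.1 hf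

theorem toA_surjective (m : ℕ) : Function.Surjective (toA m 2) :=
  Ideal.Quotient.mk_surjective

theorem map_hsym {R S : Type*} [CommRing R] [CommRing S] (f : R →+* S) (x y : R) (n : ℕ) :
    f (hsym x y n) = hsym (f x) (f y) n := by
  induction n using Nat.twoStepInduction with
  | zero => simp [hsym]
  | one => simp [hsym]
  | more n ih1 ih2 => simp [hsym, ih1, ih2]

/-- Both sides satisfy the linear recurrence with characteristic roots u and v. -/
theorem hsym_sub_hsym {R : Type*} [CommRing R] (u v : R) (n : ℕ) :
    hsym (u + v) (u * v) (n + 2) - u * v * hsym (u + v) (u * v) n = u ^ (n + 2) + v ^ (n + 2) := by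
  induction n using Nat.twoStepInduction with
  | zero => simp only [hsym]; ring
  | one => simp only [hsym]; ring
  | more n ih1 ih2 =>
    have h2 := hsym.eq_3 (u + v) (u * v) n
    have h4 := hsym.eq_3 (u + v) (u * v) (n + 2)
    linear_combination h4 - u * v * h2 + (u + v) * ih2 - u * v * ih1

/-! ### The orientation as a residue. -/

/-- The residue of `f / ((x₁ᵐ + x₂ᵐ) x₁ᵐ x₂ᵐ)` as a function of `e₁, e₂`, as a coefficient in
`x₁, x₂`. -/
def residue (m : ℕ) : MvPolynomial (Fin 2) ℚ →ₗ[ℚ] ℚ :=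
  (-1 / 2 : ℚ) • (lcoeff ℚ (Finsupp.single 0 (2 * m - 1) + Finsupp.single 1 (2 * m - 1)) ∘ₗ
    LinearMap.mulRight ℚ ((X 0 - X 1) * (X 0 ^ m - X 1 ^ m)))

theorem residue_apply (m : ℕ) (f : MvPolynomial (Fin 2) ℚ) :
    residue m f = -1 / 2 * coeff (Finsupp.single 0 (2 * m - 1) + Finsupp.single 1 (2 * m - 1))
      (f * ((X 0 - X 1) * (X 0 ^ m - X 1 ^ m))) := rfl

theorem coeff_mul_X_pow_eq_zero {σ R : Type*} [CommSemiring R] (p : MvPolynomial σ R) {d : σ →₀ ℕ}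
    {i : σ} {n : ℕ} (h : d i < n) : coeff d (p * X i ^ n) = 0 := by
  classical
  rw [X_pow_eq_monomial, coeff_mul_monomial', if_neg]
  intro hle
  have := hle i
  rw [Finsupp.single_eq_same] at this
  omega

/-- The factor x₁^m - x₂^m moves both relations into the ideal (x₁^(2m), x₂^(2m)), which does not
reach the coefficient at exponents 2m-1. The factor x₁ - x₂ is the Jacobian of (e₁, e₂). -/
theorem residue_mul_powEsymm {m : ℕ} (hm : 1 ≤ m) (g : MvPolynomial (Fin 2) ℚ) (i : Fin 2) :
    residue m (g * powEsymm m 2 (i + 1)) = 0 := by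
  rw [residue_apply, mul_eq_zero]
  right
  fin_cases i
  · have h : g * powEsymm m 2 1 * ((X 0 - X 1) * (X 0 ^ m - X 1 ^ m)) =
        g * (X 0 - X 1) * X 0 ^ (2 * m) - g * (X 0 - X 1) * X 1 ^ (2 * m) := by
      rw [powEsymm_two_one]
      ring
    change coeff _ (g * powEsymm m 2 1 * _) = 0
    rw [h, coeff_sub, coeff_mul_X_pow_eq_zero, coeff_mul_X_pow_eq_zero, sub_zero]
    · simp; omega
    · simp; omega
  · have h : g * powEsymm m 2 2 * ((X 0 - X 1) * (X 0 ^ m - X 1 ^ m)) =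
        g * (X 0 - X 1) * X 1 ^ m * X 0 ^ (2 * m) -
          g * (X 0 - X 1) * X 0 ^ m * X 1 ^ (2 * m) := by
      rw [powEsymm_two_two]
      ring
    change coeff _ (g * powEsymm m 2 2 * _) = 0
    rw [h, coeff_sub, coeff_mul_X_pow_eq_zero, coeff_mul_X_pow_eq_zero, sub_zero]
    · simp; omega
    · simp; omega

theorem residue_eq_zero_of_mem {m : ℕ} (hm : 1 ≤ m) {f : esymmSubalgebra 2}
    (hf : f ∈ powEsymmIdeal m 2) : residue m f = 0 := by
  -- Quantifying over all multiples lets the induction absorb ring scalars, for which `residue` is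
  -- not linear.
  have h : ∀ g : esymmSubalgebra 2, residue m (g * f : esymmSubalgebra 2) = 0 := by
    refine Submodule.span_induction (p := fun f _ => ∀ g : esymmSubalgebra 2,
      residue m (g * f : esymmSubalgebra 2) = 0) ?_ ?_ ?_ ?_ hf
    · rintro _ ⟨i, rfl⟩ g
      exact residue_mul_powEsymm hm g i
    · intro g
      simp
    · intro a b _ _ ha hb g
      rw [mul_add, Subalgebra.coe_add, map_add, ha, hb, add_zero]
    · intro c a _ ha g
      rw [smul_eq_mul, ← mul_assoc]
      exact ha _
  simpa using h 1

theorem coeff_X_pow_mul_X_pow (a b p q : ℕ) :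
    coeff (Finsupp.single 0 p + Finsupp.single 1 q)
      (X 0 ^ a * X 1 ^ b : MvPolynomial (Fin 2) ℚ) = if a = p ∧ b = q then 1 else 0 := by
  rw [X_pow_eq_monomial, X_pow_eq_monomial, monomial_mul, one_mul, coeff_monomial]
  congr 1
  rw [Finsupp.ext_iff, Fin.forall_fin_two]
  simp

theorem residue_top {m : ℕ} (hm : 1 ≤ m) :
    residue m ((sumGen ^ (m - 1) * prodGen ^ (m - 1) : esymmSubalgebra 2)) = 1 := by
  obtain ⟨k, rfl⟩ : ∃ k, m = k + 1 := ⟨m - 1, by omega⟩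
  rw [residue_apply, Nat.add_sub_cancel, Subalgebra.coe_mul, Subalgebra.coe_pow,
    Subalgebra.coe_pow, coe_sumGen, coe_prodGen, add_pow, Finset.sum_mul, Finset.sum_mul,
    coeff_sum]
  -- Only j = k and j = 0 in the binomial expansion reach the coefficient, each contributing -1;
  -- this fixes the factor -1/2.
  have h : ∀ j ∈ Finset.range (k + 1),
      coeff (Finsupp.single 0 (2 * (k + 1) - 1) + Finsupp.single 1 (2 * (k + 1) - 1))
        (X 0 ^ j * X 1 ^ (k - j) * (k.choose j : MvPolynomial (Fin 2) ℚ) * (X 0 * X 1) ^ k *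
          ((X 0 - X 1) * (X 0 ^ (k + 1) - X 1 ^ (k + 1)))) =
      -(if j = k then (k.choose j : ℚ) else 0) - (if j = 0 then (k.choose j : ℚ) else 0) := by
    intro j hj
    rw [Finset.mem_range] at hj
    have h1 : X 0 ^ j * X 1 ^ (k - j) * (k.choose j : MvPolynomial (Fin 2) ℚ) * (X 0 * X 1) ^ k *
        ((X 0 - X 1) * (X 0 ^ (k + 1) - X 1 ^ (k + 1))) =
        C (k.choose j : ℚ) * (X 0 ^ (j + k + (k + 2)) * X 1 ^ (k - j + k)
          - X 0 ^ (j + k + 1) * X 1 ^ (k - j + k + (k + 1))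
          - X 0 ^ (j + k + (k + 1)) * X 1 ^ (k - j + k + 1)
          + X 0 ^ (j + k) * X 1 ^ (k - j + k + (k + 2))) := by
      rw [map_natCast]
      ring
    rw [h1, coeff_C_mul, coeff_add, coeff_sub, coeff_sub, coeff_X_pow_mul_X_pow,
      coeff_X_pow_mul_X_pow, coeff_X_pow_mul_X_pow, coeff_X_pow_mul_X_pow,
      if_neg (by omega), if_neg (c := j + k = _ ∧ _) (by omega)]
    have h2 : (j + k + 1 = 2 * (k + 1) - 1 ∧ k - j + k + (k + 1) = 2 * (k + 1) - 1) ↔ j = k := by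
      omega
    have h3 : (j + k + (k + 1) = 2 * (k + 1) - 1 ∧ k - j + k + 1 = 2 * (k + 1) - 1) ↔ j = 0 := by
      omega
    simp only [h2, h3]
    split_ifs <;> ring
  rw [Finset.sum_congr rfl h, Finset.sum_sub_distrib, Finset.sum_neg_distrib,
    Finset.sum_ite_eq_of_mem' _ _ _ (by simp), Finset.sum_ite_eq_of_mem' _ _ _ (by simp)]
  norm_num

theorem residue_gen_eq_zero {m : ℕ} (hm : 1 ≤ m) {a b : ℕ} (h : a + 2 * b ≠ 3 * (m - 1)) :
    residue m ((sumGen ^ a * prodGen ^ b : esymmSubalgebra 2)) = 0 := by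
  rw [residue_apply, mul_eq_zero]
  right
  have h1 : (X 0 - X 1 : MvPolynomial (Fin 2) ℚ).IsHomogeneous 1 :=
    (isHomogeneous_X _ _).sub (isHomogeneous_X _ _)
  have h2 : (X 0 ^ m - X 1 ^ m : MvPolynomial (Fin 2) ℚ).IsHomogeneous m :=
    (isHomogeneous_X_pow _ _).sub (isHomogeneous_X_pow _ _)
  refine ((isHomogeneous_gen a b).mul (h1.mul h2)).coeff_eq_zero ?_
  rw [map_add, Finsupp.degree_single, Finsupp.degree_single]
  omega

theorem exists_isTwoGen {m : ℕ} (hm : 1 ≤ m) :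
    ∃ φ : A m 2 →ₗ[ℚ] ℚ, IsTwoGen m (toA m 2 sumGen) (toA m 2 prodGen) φ := by
  obtain ⟨g, hg⟩ := (toA m 2).toLinearMap.exists_rightInverse_of_surjective
    (LinearMap.range_eq_top.2 (toA_surjective m))
  -- The residue vanishes on the ideal, so its value does not depend on the lift chosen by the
  -- linear section g.
  have hφ : ∀ f : esymmSubalgebra 2, residue m (g (toA m 2 f)) = residue m f := by
    intro f
    rw [← sub_eq_zero, ← map_sub, ← Subalgebra.coe_sub]
    refine residue_eq_zero_of_mem hm (mem_of_toA_eq_zero ?_)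
    rw [map_sub, sub_eq_zero]
    exact LinearMap.congr_fun hg (toA m 2 f)
  refine ⟨residue m ∘ₗ (esymmSubalgebra 2).val.toLinearMap ∘ₗ g, hm, ?_, ?_, ?_, ?_, ?_, ?_⟩
  · rw [eq_top_iff]
    rintro α -
    obtain ⟨f, rfl⟩ := toA_surjective m α
    obtain ⟨q, rfl⟩ := exists_eq_sum_gen f
    rw [map_sum]
    refine sum_mem fun d _ => ?_
    rw [map_smul, map_mul, map_pow, map_pow]
    exact Submodule.smul_mem _ _ (Submodule.subset_span ⟨(d 0, d 1), rfl⟩)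
  · rw [← map_pow]
    refine toA_eq_zero (Ideal.subset_span ⟨1, Subtype.ext ?_⟩)
    rw [Subalgebra.coe_pow, coe_prodGen, mul_pow]
    exact powEsymm_two_two m
  · rintro rfl
    refine toA_eq_zero (Ideal.subset_span ⟨0, Subtype.ext ?_⟩)
    rw [coe_sumGen]
    exact (powEsymm_two_one 1).trans (by rw [pow_one, pow_one])
  · intro h2
    obtain ⟨n, rfl⟩ : ∃ n, m = n + 2 := ⟨m - 2, by omega⟩
    have hmap : ∀ k, hsym (toA (n + 2) 2 sumGen) (toA (n + 2) 2 prodGen) k =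
        toA (n + 2) 2 (hsym sumGen prodGen k) := fun k =>
      (map_hsym (toA (n + 2) 2).toRingHom _ _ k).symm
    rw [Nat.add_sub_cancel, hmap, hmap, ← map_mul, ← sub_eq_zero, ← map_sub]
    refine toA_eq_zero (Ideal.subset_span ⟨0, Subtype.ext ?_⟩)
    have hval : ∀ k, ((hsym sumGen prodGen k : esymmSubalgebra 2) : MvPolynomial (Fin 2) ℚ) =
        hsym (X 0 + X 1) (X 0 * X 1) k := fun k => by
      rw [← coe_sumGen, ← coe_prodGen]
      exact map_hsym (esymmSubalgebra 2).val.toRingHom _ _ k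
    rw [Subalgebra.coe_sub, Subalgebra.coe_mul, hval, hval, coe_prodGen, hsym_sub_hsym]
    exact powEsymm_two_one _
  · rw [← map_pow, ← map_pow, ← map_mul]
    exact (hφ _).trans (residue_top hm)
  · intro a b hab
    rw [← map_pow, ← map_pow, ← map_mul]
    exact (hφ _).trans (residue_gen_eq_zero hm hab)

end Almkvist

end

theorem theoremB (m : ℕ) (hm : 1 ≤ m) :
    ∃ φ : Almkvist.A m 2 →ₗ[ℚ] ℚ,
      Almkvist.IsOrientedAG (Almkvist.grade m 2) (3 * (m - 1)) φ ∧
      φ (Almkvist.e m 2 0 ^ (m - 1) * Almkvist.e m 2 1 ^ (m - 1)) = 1 ∧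
      (Even m → Almkvist.HasSLP (Almkvist.grade m 2) (3 * (m - 1))) ∧
      (Odd m → Almkvist.HasSLUpTo (Almkvist.grade m 2) (3 * (m - 1)) (m - 2)) ∧
      Almkvist.HasHLP (Almkvist.grade m 2) (3 * (m - 1)) ∧
      (Even m → Almkvist.HasComplexHRR (Almkvist.grade m 2) (3 * (m - 1)) φ) ∧
      (Odd m → Almkvist.HasComplexHRRUpTo (Almkvist.grade m 2) (3 * (m - 1)) φ (m - 2)) := by
  obtain ⟨φ, H⟩ := Almkvist.exists_isTwoGen hm
  rw [show Almkvist.grade m 2 = _ from funext (Almkvist.grade_eq_degSpan m)]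
  have hx : Almkvist.toA m 2 Almkvist.sumGen ∈
      Almkvist.degSpan (Almkvist.toA m 2 Almkvist.sumGen) (Almkvist.toA m 2 Almkvist.prodGen) 1 := by
    simpa using Almkvist.pow_mem_degSpan (Almkvist.toA m 2 Almkvist.sumGen)
      (Almkvist.toA m 2 Almkvist.prodGen) 1
  exact ⟨φ, H.isOrientedAG, H.map_top,
    fun h => ⟨_, hx, H.isSL le_rfl (Or.inr h)⟩,
    fun _ => ⟨_, hx, H.isSL (by omega) (Or.inl le_rfl)⟩,
    ⟨_, hx, H.isHLP⟩,
    fun h => ⟨_, hx, H.isComplexHRR le_rfl (Or.inr h)⟩,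
    fun _ => ⟨_, hx, H.isComplexHRR (by omega) (Or.inl le_rfl)⟩⟩
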